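/- A semilattice is a commutative semigroup $X$ all of whose elements are idempotent, ordered by $x\le y\iff xy=x$; put ${\uparrow}x=\{y\in X: x\le y\}$ and ${\downarrow}x=\{y\in X: y\le x\}$. A subsemilattice is a subset closed under the operation. A semitopological semilattice is a semilattice with a topology for which the operation is separately continuous. For a Hausdorff such $X$, the Lawson number $\bar\Lambda(X)$ is the smallest cardinal $\kappa$ such that for any distinct points $x,y\in X$ there is a family $\mathcal U$ of closed neighborhoods of $x$ such that $|\mathcal U|\le\kappa$ and $\bigcap\mathcal U$ is a subsemilattice of $X$ that does not contain $y$ (where $\bigcap\emptyset=X$). Proposition. Let $X$ be a Hausdorff semitopological semilattice, and consider the following conditions: (1) $X$ is $1$-Lawson, i.e. $\bar\Lambda(X)\le 1$; (2) $X$ is Lawson, i.e. its topology has a base consisting of open subsemilattices; (3) $X$ is a $V$-semilattice, i.e. for any $x\in X$ and any $y\in X\setminus{\uparrow}x$ there is a point $v\in X\setminus{\downarrow}y$ such that ${\uparrow}v$ is a neighborhood of $x$; (4) $X$ is $\mathbb I$-separated, i.e. for any distinct $x,y\in X$ there is a continuous semilattice homomorphism $f:X\to([0,1],\min)$ with $f(x)\ne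 f(y)$. Each of the conditions (2), (3), (4) implies (1). If $X$ is compact, then the conditions (1)–(4) are equivalent. If $X$ has at least two points, then (1) holds if and only if $\bar\Lambda(X)=1$; in particular, a compact Hausdorff semitopological semilattice with at least two points is Lawson if and only if $\bar\Lambda(X)=1$. -/

import Mathlib

open Topology Set

universe u

/-- A meet-semilattice endowed with a topology (a topologized semilattice) is semitopological
if the semilattice operation is separately continuous. -/
class SemitopologicalSemilattice (X : Type u) [SemilatticeInf X] [TopologicalSpace X] :
    Prop where
  continuous_const_inf : ∀ a : X, Continuous fun x : X => a ⊓ x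
  continuous_inf_const : ∀ a : X, Continuous fun x : X => x ⊓ a

/-- The cardinals `κ` such that for any distinct points `x, y` there is a family `𝒰` of at most
`κ` closed neighborhoods of `x` whose intersection is a subsemilattice that misses `y`. -/
def lawsonCardinals (X : Type u) [SemilatticeInf X] [TopologicalSpace X] :
    Set Cardinal.{u} :=
  {κ | ∀ x y : X, x ≠ y → ∃ 𝒰 : Set (Set X),
    (∀ U ∈ 𝒰, IsClosed U ∧ U ∈ 𝓝 x) ∧ Cardinal.mk 𝒰 ≤ κ ∧ InfClosed (⋂₀ 𝒰) ∧ y ∉ ⋂₀ 𝒰}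

/-- The Lawson number of a Hausdorff topologized semilattice. -/
noncomputable def lawsonNumber (X : Type u) [SemilatticeInf X] [TopologicalSpace X] :
    Cardinal.{u} :=
  sInf (lawsonCardinals X)

/-- In the Hausdorff case the minimum defining the Lawson number is over a nonempty set. -/
theorem lawsonCardinals_nonempty (X : Type u) [SemilatticeInf X] [TopologicalSpace X]
    [T2Space X] : (lawsonCardinals X).Nonempty := by
  refine ⟨Cardinal.mk (Set X), fun x y hxy => ?_⟩
  have key : ∀ z : X, z ≠ x → z ∉ ⋂₀ {U : Set X | IsClosed U ∧ U ∈ 𝓝 x} := by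
    intro z hz hmem
    obtain ⟨U, V, hU, hV, hxU, hzV, hd⟩ := t2_separation hz.symm
    exact hmem Vᶜ ⟨hV.isClosed_compl,
      Filter.mem_of_superset (hU.mem_nhds hxU) hd.subset_compl_right⟩ hzV
  refine ⟨{U | IsClosed U ∧ U ∈ 𝓝 x}, fun U hU => hU, Cardinal.mk_set_le _, ?_, key y hxy.symm⟩
  have hx : ∀ z ∈ ⋂₀ {U : Set X | IsClosed U ∧ U ∈ 𝓝 x}, z = x :=
    fun z hz => by_contra fun h => key z h hz
  intro a ha b hb
  rw [hx a ha, hx b hb, inf_idem]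
  exact fun U hU => mem_of_mem_nhds hU.2

/-- `κ`-Lawson topologized semilattices. -/
def IsCardinalLawson (X : Type u) [SemilatticeInf X] [TopologicalSpace X]
    (κ : Cardinal.{u}) : Prop :=
  T2Space X ∧ lawsonNumber X ≤ κ

/-- Lawson: the topology has a base consisting of open subsemilattices. -/
def IsLawsonSemilattice (X : Type u) [SemilatticeInf X] [TopologicalSpace X] : Prop :=
  ∃ B : Set (Set X), TopologicalSpace.IsTopologicalBasis B ∧
    ∀ U ∈ B, IsOpen U ∧ InfClosed U

/-- `V`-semilattices; `Ici x` is the upper set `↑x` and `Iic y` the lower set `↓y`. -/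
def IsVSemilattice (X : Type u) [SemilatticeInf X] [TopologicalSpace X] : Prop :=
  ∀ x y : X, y ∉ Ici x → ∃ v : X, v ∉ Iic y ∧ Ici v ∈ 𝓝 x

/-- `𝕀`-separated: continuous homomorphisms to `([0,1], min)` separate points. -/
def IsUnitIntervalSeparated (X : Type u) [SemilatticeInf X] [TopologicalSpace X] : Prop :=
  ∀ x y : X, x ≠ y → ∃ f : InfHom X unitInterval, Continuous f ∧ f x ≠ f y

/-!
The argument never uses joint continuity of the operation. Separate continuity suffices for the
three facts that carry everything: the sets `↑a` and `↓a` are closed, the closure of a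
subsemilattice is a subsemilattice (`InfClosed.closure`), and `↑a` is a neighborhood of every
point above `b` as soon as it is a neighborhood of `b` (`Ici_mem_nhds_of_le`).

A closed neighborhood witnessing that `X` is `1`-Lawson at `x ≠ y` is the closure of an open
subsemilattice: of a small basic set if `X` is Lawson, of the preimage of a ray of `[0,1]` if `X` is
`𝕀`-separated, and, in a `V`-semilattice with `x ≤ y`, of the lower set `X \ ↑v` for a filter `↑v`
around `y`. In a `V`-semilattice with `x ≰ y`, a filter `↑v` around `x` will do.

In a compact `X`, a `1`-Lawson semilattice has arbitrarily small closed subsemilattice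
neighborhoods of every point, and each of them has a least element `w`. Thus every neighborhood of
`x` contains some `w` such that `↑w` is a neighborhood of `x`
(`exists_mem_Ici_mem_nhds`). So `X` is a `V`-semilattice. It also makes the relation
"`↑a` is a neighborhood of `b`" interpolative, so that a Urysohn-type construction along the
dyadic rationals yields a chain `(v_t)`, and `z ↦ sup {t | v_t ≤ z}` is a continuous homomorphism;
thus `X` is `𝕀`-separated. Finally, compactness turns the open subsemilattices that separate the
points of an `𝕀`-separated semilattice into a base, so that `X` is Lawson.
-/

/-! ### Closed sets in semitopological semilattices -/

section Closed

variable {X : Type u} [SemilatticeInf X] [TopologicalSpace X] [SemitopologicalSemilattice X]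

instance SemitopologicalSemilattice.closedIciTopology [T2Space X] : ClosedIciTopology X where
  isClosed_Ici a := by
    have h : Ici a = {x : X | a ⊓ x = a} := by ext x; simp
    rw [h]
    exact isClosed_eq (SemitopologicalSemilattice.continuous_const_inf a) continuous_const

instance SemitopologicalSemilattice.closedIicTopology [T2Space X] : ClosedIicTopology X where
  isClosed_Iic a := by
    have h : Iic a = {x : X | a ⊓ x = x} := by ext x; simp
    rw [h]
    exact isClosed_eq (SemitopologicalSemilattice.continuous_const_inf a) continuous_id

theorem InfClosed.closure {s : Set X} (hs : InfClosed s) : InfClosed (closure s) :=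
  fun _ ha _ hb => map_mem_closure₂' SemitopologicalSemilattice.continuous_const_inf
    SemitopologicalSemilattice.continuous_inf_const ha hb fun _ hx _ hy => hs hx hy

theorem Ici_mem_nhds_of_le {a b c : X} (h : Ici a ∈ 𝓝 b) (hbc : b ≤ c) : Ici a ∈ 𝓝 c := by
  have hc : Filter.Tendsto (fun x => b ⊓ x) (𝓝 c) (𝓝 b) := by
    have := (SemitopologicalSemilattice.continuous_const_inf b).tendsto c
    rwa [inf_eq_left.2 hbc] at this
  filter_upwards [hc h] with x hx
  exact le_trans hx inf_le_right

/-- A nonempty closed subsemilattice of a compact semilattice has a least element: the sets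
`↓a ∩ s` with `a ∈ s` have the finite intersection property. -/
theorem InfClosed.exists_isLeast [T2Space X] [CompactSpace X] {s : Set X} (hs : InfClosed s)
    (hc : IsClosed s) (hne : s.Nonempty) : ∃ m, IsLeast s m := by
  have : Nonempty s := hne.to_subtype
  have hclosed : ∀ a : s, IsClosed (Iic (a : X) ∩ s) := fun a => isClosed_Iic.inter hc
  obtain ⟨m, hm⟩ := IsCompact.nonempty_iInter_of_directed_nonempty_isCompact_isClosed
    (fun a : s => Iic (a : X) ∩ s)
    (fun a b => ⟨⟨a ⊓ b, hs a.2 b.2⟩,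
      inter_subset_inter_left _ (Iic_subset_Iic.2 inf_le_left),
      inter_subset_inter_left _ (Iic_subset_Iic.2 inf_le_right)⟩)
    (fun a => ⟨a, le_rfl, a.2⟩) (fun a => (hclosed a).isCompact) hclosed
  rw [mem_iInter] at hm
  exact ⟨m, (hm (Classical.arbitrary s)).2, fun a ha => (hm ⟨a, ha⟩).1⟩

/-- In a compact space, a family of sets whose closures separate `x` from every other point is
arbitrarily small around `x` as soon as it is stable under finite intersections. -/
theorem exists_closure_subset_of_separating {Y : Type*} [TopologicalSpace Y] [CompactSpace Y]
    {x : Y} {S : Set (Set Y)} (huniv : univ ∈ S) (hinter : ∀ U ∈ S, ∀ V ∈ S, U ∩ V ∈ S)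
    (hsep : ∀ y, x ≠ y → ∃ U ∈ S, y ∉ closure U) {W : Set Y} (hW : W ∈ 𝓝 x) :
    ∃ U ∈ S, closure U ⊆ W := by
  have : Nonempty S := ⟨⟨univ, huniv⟩⟩
  obtain ⟨U, hU⟩ := exists_subset_nhds_of_compactSpace (V := fun U : S => closure (U : Set Y))
    (fun U V => ⟨⟨U ∩ V, hinter U U.2 V V.2⟩, closure_mono inter_subset_left,
      closure_mono inter_subset_right⟩) (fun _ => isClosed_closure) (U := W) (by
      intro y hy
      have hxy : x = y := by
        by_contra hne
        obtain ⟨U, hU, hyU⟩ := hsep y hne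
        exact hyU (mem_iInter.1 hy ⟨U, hU⟩)
      rwa [← hxy])
  exact ⟨U, U.2, hU⟩

end Closed

/-! ### The Lawson number -/

section LawsonNumber

variable {X : Type u} [SemilatticeInf X] [TopologicalSpace X] [T2Space X]

theorem lawsonNumber_mem : lawsonNumber X ∈ lawsonCardinals X :=
  csInf_mem (lawsonCardinals_nonempty X)

/-- At most one neighborhood can be traded for exactly one, the intersection of the family. -/
theorem isCardinalLawson_one_iff : IsCardinalLawson X 1 ↔
    ∀ x y : X, x ≠ y → ∃ U ∈ 𝓝 x, IsClosed U ∧ InfClosed U ∧ y ∉ U := by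
  constructor
  · rintro ⟨-, h⟩ x y hxy
    obtain ⟨𝒰, h𝒰, hcard, hinf, hy⟩ := lawsonNumber_mem x y hxy
    have hsub : 𝒰.Subsingleton := Cardinal.mk_le_one_iff_set_subsingleton.1 (hcard.trans h)
    exact ⟨⋂₀ 𝒰, (Filter.sInter_mem hsub.finite).2 fun U hU => (h𝒰 U hU).2,
      isClosed_sInter fun U hU => (h𝒰 U hU).1, hinf, hy⟩
  · intro h
    refine ⟨inferInstance, csInf_le' fun x y hxy => ?_⟩
    obtain ⟨U, hU, hc, hinf, hy⟩ := h x y hxy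
    exact ⟨{U}, by simp [hU, hc], by simp, by simpa using hinf, by simpa using hy⟩

theorem lawsonNumber_ne_zero [Nontrivial X] : lawsonNumber X ≠ 0 := by
  intro h0
  obtain ⟨x, y, hxy⟩ := exists_pair_ne X
  obtain ⟨𝒰, -, hcard, -, hy⟩ := lawsonNumber_mem x y hxy
  rw [h0, nonpos_iff_eq_zero, Cardinal.mk_set_eq_zero_iff] at hcard
  simp [hcard] at hy

theorem isCardinalLawson_one_iff_lawsonNumber_eq_one [Nontrivial X] :
    IsCardinalLawson X 1 ↔ lawsonNumber X = 1 :=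
  ⟨fun h => le_antisymm h.2 (Cardinal.one_le_iff_ne_zero.2 lawsonNumber_ne_zero),
    fun h => ⟨inferInstance, h.le⟩⟩

end LawsonNumber

/-! ### Conditions implying the 1-Lawson property -/

theorem IsUnitIntervalSeparated.exists_isOpen {X : Type u} [SemilatticeInf X]
    [TopologicalSpace X] (h : IsUnitIntervalSeparated X) {x y : X} (hxy : x ≠ y) :
    ∃ U, IsOpen U ∧ InfClosed U ∧ x ∈ U ∧ y ∉ closure U := by
  obtain ⟨f, hf, hne⟩ := h x y hxy
  rcases lt_or_gt_of_ne hne with hlt | hlt <;> obtain ⟨m, hm₁, hm₂⟩ := exists_between hlt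
  · refine ⟨f ⁻¹' Iio m, isOpen_Iio.preimage hf, fun a ha b _ => ?_, hm₁, fun hy => ?_⟩
    · rw [mem_preimage, map_inf]
      exact (inf_le_left : f a ⊓ f b ≤ f a).trans_lt ha
    · have := closure_minimal (preimage_mono Iio_subset_Iic_self) (isClosed_Iic.preimage hf) hy
      exact not_lt_of_ge this hm₂
  · refine ⟨f ⁻¹' Ioi m, isOpen_Ioi.preimage hf, fun a ha b hb => ?_, hm₂, fun hy => ?_⟩
    · rw [mem_preimage, map_inf]
      exact lt_inf_iff.2 ⟨mem_preimage.1 ha, mem_preimage.1 hb⟩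
    · have := closure_minimal (preimage_mono Ioi_subset_Ici_self) (isClosed_Ici.preimage hf) hy
      exact not_lt_of_ge this hm₁

section ImpliesLawson

variable {X : Type u} [SemilatticeInf X] [TopologicalSpace X] [T2Space X]
  [SemitopologicalSemilattice X]

theorem isCardinalLawson_one_of_isOpen
    (h : ∀ x y : X, x ≠ y → ∃ U, IsOpen U ∧ InfClosed U ∧ x ∈ U ∧ y ∉ closure U) :
    IsCardinalLawson X 1 := by
  refine isCardinalLawson_one_iff.2 fun x y hxy => ?_
  obtain ⟨U, hU, hinf, hx, hy⟩ := h x y hxy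
  exact ⟨closure U, Filter.mem_of_superset (hU.mem_nhds hx) subset_closure, isClosed_closure,
    hinf.closure, hy⟩

theorem IsLawsonSemilattice.isCardinalLawson_one (h : IsLawsonSemilattice X) :
    IsCardinalLawson X 1 := by
  obtain ⟨B, hB, hopen⟩ := h
  refine isCardinalLawson_one_of_isOpen fun x y hxy => ?_
  obtain ⟨V, W, hV, hW, hxV, hyW, hd⟩ := t2_separation hxy
  obtain ⟨U, hU, hxU, hUV⟩ := hB.exists_subset_of_mem_open hxV hV
  exact ⟨U, (hopen U hU).1, (hopen U hU).2, hxU, fun hy =>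
    ((hd.mono_left hUV).closure_left hW).le_bot ⟨hy, hyW⟩⟩

theorem IsVSemilattice.isCardinalLawson_one (h : IsVSemilattice X) : IsCardinalLawson X 1 := by
  refine isCardinalLawson_one_iff.2 fun x y hxy => ?_
  by_cases hle : x ≤ y
  · -- Here `y ≰ x`, and the complement of a filter `↑v` around `y` is a lower set around `x`.
    obtain ⟨v, hv, hnhds⟩ := h y x fun hyx => hxy (le_antisymm hle hyx)
    have hinf : InfClosed (Ici v)ᶜ := fun a ha b _ hab => ha (le_trans hab inf_le_left)
    refine ⟨closure (Ici v)ᶜ, Filter.mem_of_superset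
      (isClosed_Ici.isOpen_compl.mem_nhds hv) subset_closure, isClosed_closure, hinf.closure, ?_⟩
    rwa [closure_compl, notMem_compl_iff, mem_interior_iff_mem_nhds]
  · obtain ⟨v, hv, hnhds⟩ := h x y hle
    exact ⟨Ici v, hnhds, isClosed_Ici, fun a ha b hb => le_inf ha hb, hv⟩

end ImpliesLawson

/-! ### Dyadic interpolation -/

section Dyadic

variable {α : Type*}

/-- One step of dyadic refinement: keep the entry `s k` at the even index `2 * k`, and insert
`mid (s k) (s (k + 1))` at the odd index `2 * k + 1`. -/
def dyadicRefine (mid : α → α → α) (s : ℕ → α) (k : ℕ) : α :=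
  if k % 2 = 0 then s (k / 2) else mid (s (k / 2)) (s (k / 2 + 1))

theorem dyadicRefine_two_mul (mid : α → α → α) (s : ℕ → α) (k : ℕ) :
    dyadicRefine mid s (2 * k) = s k := by
  simp [dyadicRefine]

theorem dyadicRefine_two_mul_add_one (mid : α → α → α) (s : ℕ → α) (k : ℕ) :
    dyadicRefine mid s (2 * k + 1) = mid (s k) (s (k + 1)) := by
  have h : (2 * k + 1) / 2 = k := by omega
  simp [dyadicRefine, h, Nat.add_mod]

/-- A transitive interpolative relation `r` interpolates, between any two related elements, a family
indexed by the dyadic rationals of `[0, 1]`; the entry `v n k` has the index `k / 2 ^ n`. -/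
theorem exists_dyadic_interpolation {r : α → α → Prop} (htrans : ∀ a b c, r a b → r b c → r a c)
    (hinterp : ∀ a b, r a b → ∃ c, r a c ∧ r c b) {a b : α} (hab : r a b) :
    ∃ v : ℕ → ℕ → α, v 0 0 = a ∧ v 0 1 = b ∧
      ∀ n k m l, k * 2 ^ m < l * 2 ^ n → l ≤ 2 ^ m → r (v n k) (v m l) := by
  have hmid : ∀ a b, ∃ c, r a b → r a c ∧ r c b := fun a b => by
    by_cases h : r a b
    · exact (hinterp a b h).imp fun c hc _ => hc
    · exact ⟨a, fun h' => absurd h' h⟩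
  choose mid hmid using hmid
  let v : ℕ → ℕ → α := fun n => (dyadicRefine mid)^[n] fun k => if k = 0 then a else b
  have hv : ∀ n, v (n + 1) = dyadicRefine mid (v n) := fun n =>
    Function.iterate_succ_apply' _ _ _
  have hstep : ∀ n k, k < 2 ^ n → r (v n k) (v n (k + 1)) := by
    intro n
    induction n with
    | zero =>
      intro k hk
      obtain rfl : k = 0 := by simpa using hk
      simpa [v] using hab
    | succ n ih =>
      intro k hk
      rw [pow_succ] at hk
      rw [hv]
      obtain ⟨j, rfl | rfl⟩ := Nat.even_or_odd' k
      · rw [dyadicRefine_two_mul, dyadicRefine_two_mul_add_one]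
        exact (hmid _ _ (ih j (by omega))).1
      · rw [dyadicRefine_two_mul_add_one, show 2 * j + 1 + 1 = 2 * (j + 1) by ring,
          dyadicRefine_two_mul]
        exact (hmid _ _ (ih j (by omega))).2
  have hlt : ∀ n i j, i < j → j ≤ 2 ^ n → r (v n i) (v n j) := by
    intro n i j hij
    induction j, hij using Nat.le_induction with
    | base => exact fun h => hstep n i h
    | succ j _ ih => exact fun h => htrans _ _ _ (ih (by omega)) (hstep n j h)
  have hshift : ∀ n m k, v (n + m) (k * 2 ^ m) = v n k := by
    intro n m k
    induction m with
    | zero => simp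
    | succ m ih =>
      rw [← add_assoc, hv, show k * 2 ^ (m + 1) = 2 * (k * 2 ^ m) by ring, dyadicRefine_two_mul, ih]
  refine ⟨v, rfl, rfl, fun n k m l hkl hl => ?_⟩
  rw [← hshift n m k, ← hshift m n l, add_comm m n]
  refine hlt _ _ _ hkl ?_
  rw [add_comm n m, pow_add]
  exact Nat.mul_le_mul_right _ hl

theorem exists_dyadic_between {s t : ℝ} (hs : 0 ≤ s) (hst : s < t) :
    ∃ n k : ℕ, s < k / 2 ^ n ∧ (k : ℝ) / 2 ^ n < t := by
  obtain ⟨n, hn⟩ := exists_pow_lt_of_lt_one (sub_pos.2 hst) (by norm_num : (2⁻¹ : ℝ) < 1)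
  have hpos : (0 : ℝ) < 2 ^ n := by positivity
  have hn' : 1 < (t - s) * 2 ^ n := by
    rwa [inv_pow, inv_lt_iff_one_lt_mul₀ hpos] at hn
  refine ⟨n, ⌊s * 2 ^ n⌋₊ + 1, ?_, ?_⟩
  · rw [lt_div_iff₀ hpos]
    exact_mod_cast Nat.lt_floor_add_one (s * 2 ^ n)
  · rw [div_lt_iff₀ hpos]
    have := Nat.floor_le (mul_nonneg hs hpos.le)
    push_cast
    linarith

end Dyadic

/-! ### Homomorphisms into a linear order -/

section Urysohn

variable {X : Type u} [SemilatticeInf X] [TopologicalSpace X] [T2Space X]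
  [SemitopologicalSemilattice X]

/-- The Urysohn-type construction. Let `S` be a set of points of `X` labelled by elements of a
linear order `I`, such that the labels are dense in `I` and `↑p` is a neighborhood of `q` whenever
the label of `p` is less than that of `q`. Then sending `z` to the supremum of the labels of the
points below `z` is a continuous semilattice homomorphism. -/
theorem exists_continuous_infHom_sSup {I : Type*} [CompleteLinearOrder I] [DenselyOrdered I]
    [TopologicalSpace I] [OrderTopology I] {S : Set (I × X)}
    (hS : ∀ s p t q, (s, p) ∈ S → (t, q) ∈ S → s < t → Ici p ∈ 𝓝 q)
    (hdense : ∀ s t : I, s < t → ∃ u p, (u, p) ∈ S ∧ s < u ∧ u < t) :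
    ∃ f : InfHom X I, Continuous f ∧ ∀ z, f z = sSup {s | ∃ p, (s, p) ∈ S ∧ p ≤ z} := by
  let f : X → I := fun z => sSup {s | ∃ p, (s, p) ∈ S ∧ p ≤ z}
  have hlt : ∀ {c z}, c < f z ↔ ∃ s p, (s, p) ∈ S ∧ p ≤ z ∧ c < s := fun {c z} => by
    simp only [f, lt_sSup_iff, mem_ofPred_eq]
    constructor
    · rintro ⟨s, ⟨p, hp, hpz⟩, hc⟩
      exact ⟨s, p, hp, hpz, hc⟩
    · rintro ⟨s, p, hp, hpz, hc⟩
      exact ⟨s, ⟨p, hp, hpz⟩, hc⟩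
  have hle : ∀ {s p t q}, (s, p) ∈ S → (t, q) ∈ S → s < t → p ≤ q :=
    fun hp hq hst => mem_of_mem_nhds (hS _ _ _ _ hp hq hst)
  have hmono : Monotone f := fun z w hzw =>
    sSup_le_sSup fun s ⟨p, hp, hpz⟩ => ⟨p, hp, hpz.trans hzw⟩
  refine ⟨⟨f, fun z w => le_antisymm (hmono.map_inf_le z w) (le_of_forall_lt fun c hc => ?_)⟩,
    continuous_iff_continuousAt.2 fun z => tendsto_order.2 ⟨fun c hc => ?_, fun c hc => ?_⟩,
    fun z => rfl⟩
  · obtain ⟨s, p, hp, hpz, hcs⟩ := hlt.1 (lt_inf_iff.1 hc).1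
    obtain ⟨t, q, hq, hqw, hct⟩ := hlt.1 (lt_inf_iff.1 hc).2
    -- A label strictly below both `s` and `t` gives a point below both `z` and `w`.
    obtain ⟨u, m, hm, hcu, hu⟩ := hdense c (s ⊓ t) (lt_inf_iff.2 ⟨hcs, hct⟩)
    exact hlt.2 ⟨u, m, hm, le_inf ((hle hm hp (lt_inf_iff.1 hu).1).trans hpz)
      ((hle hm hq (lt_inf_iff.1 hu).2).trans hqw), hcu⟩
  · obtain ⟨s, p, hp, hpz, hcs⟩ := hlt.1 hc
    obtain ⟨u, m, hm, hcu, hus⟩ := hdense c s hcs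
    filter_upwards [Ici_mem_nhds_of_le (hS _ _ _ _ hm hp hus) hpz] with w hw
    exact hlt.2 ⟨u, m, hm, hw, hcu⟩
  · obtain ⟨u, m, hm, hu, huc⟩ := hdense _ c hc
    have hmz : z ∉ Ici m := fun h => not_lt_of_ge (show u ≤ f z from le_sSup ⟨m, hm, h⟩) hu
    filter_upwards [isClosed_Ici.isOpen_compl.mem_nhds hmz] with w hw
    refine lt_of_le_of_lt (sSup_le ?_) huc
    rintro s ⟨p, hp, hpw⟩
    exact le_of_not_gt fun hus => hw ((hle hm hp hus).trans hpw)

end Urysohn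

/-! ### Compact semilattices -/

section Compact

variable {X : Type u} [SemilatticeInf X] [TopologicalSpace X] [T2Space X]
  [SemitopologicalSemilattice X] [CompactSpace X]

/-- The witness `w` is the least element of a closed subsemilattice neighborhood of `x` inside
`W`. -/
theorem exists_mem_Ici_mem_nhds (h : IsCardinalLawson X 1) {x : X} {W : Set X} (hW : W ∈ 𝓝 x) :
    ∃ w ∈ W, Ici w ∈ 𝓝 x := by
  obtain ⟨U, ⟨hUx, hUc, hUi⟩, hUW⟩ := exists_closure_subset_of_separating
    (S := {U | U ∈ 𝓝 x ∧ IsClosed U ∧ InfClosed U})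
    ⟨Filter.univ_mem, isClosed_univ, infClosed_univ⟩
    (fun U hU V hV => ⟨Filter.inter_mem hU.1 hV.1, hU.2.1.inter hV.2.1, hU.2.2.inter hV.2.2⟩)
    (fun y hxy => by
      obtain ⟨U, hU, hc, hi, hy⟩ := isCardinalLawson_one_iff.1 h x y hxy
      exact ⟨U, ⟨hU, hc, hi⟩, by rwa [hc.closure_eq]⟩) hW
  obtain ⟨w, hw⟩ := hUi.exists_isLeast hUc ⟨x, mem_of_mem_nhds hUx⟩
  exact ⟨w, hUW (subset_closure hw.1), Filter.mem_of_superset hUx hw.2⟩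

theorem IsCardinalLawson.isVSemilattice (h : IsCardinalLawson X 1) : IsVSemilattice X :=
  fun _ _ hy => exists_mem_Ici_mem_nhds h (isClosed_Iic.isOpen_compl.mem_nhds hy)

theorem IsCardinalLawson.exists_infHom (h : IsCardinalLawson X 1) {x y : X} (hxy : ¬ x ≤ y) :
    ∃ f : InfHom X unitInterval, Continuous f ∧ f x ≠ f y := by
  obtain ⟨w, hwy, hwx⟩ := h.isVSemilattice x y hxy
  obtain ⟨v, hv₀, hv₁, hv⟩ := exists_dyadic_interpolation (r := fun a b : X => Ici a ∈ 𝓝 b)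
    (fun a b c hab hbc => Ici_mem_nhds_of_le hab (mem_of_mem_nhds hbc))
    (fun a b hab => by
      obtain ⟨c, hc, hcb⟩ := exists_mem_Ici_mem_nhds h (interior_mem_nhds.2 hab)
      exact ⟨c, mem_interior_iff_mem_nhds.1 hc, hcb⟩) hwx
  let S : Set (unitInterval × X) := {a | ∃ n k : ℕ, (a.1 : ℝ) = k / 2 ^ n ∧ a.2 = v n k}
  have hle : ∀ {s : unitInterval} {n k : ℕ}, (s : ℝ) = k / 2 ^ n → k ≤ 2 ^ n := by
    intro s n k hs
    have := s.2.2
    rw [hs, div_le_one (by positivity)] at this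
    exact_mod_cast this
  obtain ⟨f, hf, hfS⟩ := exists_continuous_infHom_sSup (S := S)
    (by
      rintro s _ t _ ⟨n, k, hs, rfl⟩ ⟨m, l, ht, rfl⟩ hst
      refine hv n k m l ?_ (hle ht)
      have : (s : ℝ) < t := hst
      rw [hs, ht, div_lt_div_iff₀ (by positivity) (by positivity)] at this
      exact_mod_cast this)
    (by
      intro s t hst
      obtain ⟨n, k, hsk, hkt⟩ := exists_dyadic_between s.2.1 (show (s : ℝ) < t from hst)
      exact ⟨⟨k / 2 ^ n, s.2.1.trans hsk.le, hkt.le.trans t.2.2⟩, v n k, ⟨n, k, rfl, rfl⟩,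
        hsk, hkt⟩)
  refine ⟨f, hf, ?_⟩
  have hx : f x = 1 := by
    rw [hfS]
    exact le_antisymm le_top (le_sSup ⟨x, ⟨0, 1, by simp, hv₁.symm⟩, le_rfl⟩)
  have hy : f y = 0 := by
    rw [hfS]
    refine le_antisymm (sSup_le ?_) bot_le
    rintro s ⟨_, ⟨n, k, hs, rfl⟩, hky⟩
    -- An index `k > 0` would give `w ≤ v n k ≤ y`.
    obtain rfl | hk := Nat.eq_zero_or_pos k
    · exact le_of_eq (Subtype.ext (by simpa using hs))
    · have hwk : w ≤ v n k := by
        have := hv 0 0 n k (by simpa using hk) (hle hs)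
        rw [hv₀] at this
        exact mem_of_mem_nhds this
      exact absurd (hwk.trans hky) hwy
  rw [hx, hy]
  exact one_ne_zero

theorem IsCardinalLawson.isUnitIntervalSeparated (h : IsCardinalLawson X 1) :
    IsUnitIntervalSeparated X := by
  intro x y hxy
  by_cases hle : x ≤ y
  · obtain ⟨f, hf, hne⟩ := h.exists_infHom fun hyx => hxy (le_antisymm hle hyx)
    exact ⟨f, hf, hne.symm⟩
  · exact h.exists_infHom hle

end Compact

theorem IsUnitIntervalSeparated.isLawsonSemilattice {X : Type u} [SemilatticeInf X]
    [TopologicalSpace X] [CompactSpace X] (h : IsUnitIntervalSeparated X) :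
    IsLawsonSemilattice X := by
  refine ⟨{U | IsOpen U ∧ InfClosed U}, TopologicalSpace.isTopologicalBasis_of_isOpen_of_nhds
    (fun U hU => hU.1) fun x W hx hW => ?_, fun U hU => hU⟩
  obtain ⟨U, ⟨hUx, hUo, hUi⟩, hUW⟩ := exists_closure_subset_of_separating
    (S := {U | x ∈ U ∧ IsOpen U ∧ InfClosed U}) ⟨mem_univ x, isOpen_univ, infClosed_univ⟩
    (fun U hU V hV => ⟨⟨hU.1, hV.1⟩, hU.2.1.inter hV.2.1, hU.2.2.inter hV.2.2⟩)
    (fun y hxy => by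
      obtain ⟨U, hUo, hUi, hx, hy⟩ := h.exists_isOpen hxy
      exact ⟨U, ⟨hx, hUo, hUi⟩, hy⟩) (hW.mem_nhds hx)
  exact ⟨U, ⟨hUo, hUi⟩, hUx, subset_closure.trans hUW⟩

theorem mainTheorem4 (X : Type u) [SemilatticeInf X] [TopologicalSpace X] [T2Space X]
    [SemitopologicalSemilattice X] :
    (IsLawsonSemilattice X → IsCardinalLawson X 1) ∧
    (IsVSemilattice X → IsCardinalLawson X 1) ∧
    (IsUnitIntervalSeparated X → IsCardinalLawson X 1) ∧
    (CompactSpace X →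
      [IsCardinalLawson X 1, IsLawsonSemilattice X, IsVSemilattice X, IsUnitIntervalSeparated X].TFAE) ∧
    (Nontrivial X → (IsCardinalLawson X 1 ↔ lawsonNumber X = 1)) ∧
    (CompactSpace X → Nontrivial X → (IsLawsonSemilattice X ↔ lawsonNumber X = 1)) := by
  refine ⟨fun h => h.isCardinalLawson_one, fun h => h.isCardinalLawson_one,
    fun h => isCardinalLawson_one_of_isOpen fun _ _ => h.exists_isOpen, fun _ => ?_,
    fun _ => isCardinalLawson_one_iff_lawsonNumber_eq_one, fun _ _ => ?_⟩
  · tfae_have 1 → 3 := fun h => h.isVSemilattice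
    tfae_have 3 → 1 := fun h => h.isCardinalLawson_one
    tfae_have 1 → 4 := fun h => h.isUnitIntervalSeparated
    tfae_have 4 → 2 := fun h => h.isLawsonSemilattice
    tfae_have 2 → 1 := fun h => h.isCardinalLawson_one
    tfae_finish
  · rw [← isCardinalLawson_one_iff_lawsonNumber_eq_one]
    exact ⟨fun h => h.isCardinalLawson_one,
      fun h => h.isUnitIntervalSeparated.isLawsonSemilattice⟩
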